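/- Let $(Q,\cdot,\backslash,/)$ be a (nonempty) quasigroup, i.e. the identities $x\cdot(x\backslash y)=y$, $(y/x)\cdot x=y$, $x\backslash(x\cdot y)=y$, $(y\cdot x)/x=y$ hold. A congruence $V$ of $(Q,\cdot,\backslash,/)$, regarded as a subquasigroup of $Q\times Q$, is called central if the diagonal $\{(q,q)\mid q\in Q\}$ is a normal subquasigroup of $V$, i.e. an equivalence class of some congruence of the quasigroup $V$. A center of $Q$ is a class of the greatest central congruence of $Q$, and $Q$ is central (in the sense of Belyavskaya and Smith) if it coincides with its center. An autotopy of $Q$ is a triple $(\alpha,\beta,\gamma)$ of permutations of $Q$ with $\alpha x\cdot\beta y=\gamma(x\cdot y)$ for all $x,y\in Q$; autotopies form a group under componentwise composition. Let $N^A_l$, $N^A_m$, $N^A_r$ be the subgroups of the autotopies of the form $(\alpha,\varepsilon,\gamma)$, $(\alpha,\beta,\varepsilon)$, $(\varepsilon,\beta,\gamma)$, respectively, where $\varepsilon$ is the identity map. The left, right and middle A-centers of $Q$ are $$Z^A_l=(N^A_r\times N^A_m)\cap N^A_l,\qquad Z^A_r=(N^A_l\times N^A_m)\cap N^A_r,\qquad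 Z^A_m=(N^A_l\times N^A_r)\cap N^A_m ,$$ where $\times$ is the internal direct product in the autotopy group. Their components are the permutation groups ${}_1Z^A_l$, ${}_3Z^A_l$, ${}_2Z^A_r$, ${}_3Z^A_r$, ${}_1Z^A_m$, ${}_2Z^A_m$, where ${}_iZ$ is the group of the $i$-th components of the elements of $Z$. The quasigroup $Q$ is A-central if at least one of these components acts transitively on $Q$. Then every quasigroup that is central in the sense of Belyavskaya and Smith is A-central. -/

import Mathlib

/-- A quasigroup `(Q, ·, \, /)`; `ldiv x y` is `x \ y` and `rdiv y x` is `y / x`. -/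
class QGroup (Q : Type*) extends Mul Q where
  ldiv : Q → Q → Q
  rdiv : Q → Q → Q
  mul_ldiv : ∀ x y : Q, x * ldiv x y = y
  rdiv_mul : ∀ x y : Q, rdiv y x * x = y
  ldiv_mul : ∀ x y : Q, ldiv x (x * y) = y
  mul_rdiv : ∀ x y : Q, rdiv (y * x) x = y

namespace QGroup

/-- A congruence of the quasigroup `(Q, ·, \, /)`. -/
structure Congruence (Q : Type*) [QGroup Q] extends Setoid Q where
  mul_compat : ∀ {a b c d : Q}, r a b → r c d → r (a * c) (b * d)
  ldiv_compat : ∀ {a b c d : Q}, r a b → r c d → r (ldiv a c) (ldiv b d)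
  rdiv_compat : ∀ {a b c d : Q}, r a b → r c d → r (rdiv a c) (rdiv b d)

section Center

variable {Q : Type*} [QGroup Q]

/-- The elements `(fst, snd)` of a congruence `V`, regarded as a subset of `Q × Q`. -/
@[ext]
structure Congruence.Pairs (V : Congruence Q) where
  fst : Q
  snd : Q
  rel : V.r fst snd

/-- A congruence `V` of `Q`, as a subquasigroup of `Q × Q` with componentwise operations. -/
instance Congruence.instPairs (V : Congruence Q) : QGroup V.Pairs where
  mul p q := ⟨p.fst * q.fst, p.snd * q.snd, V.mul_compat p.rel q.rel⟩
  ldiv p q := ⟨ldiv p.fst q.fst, ldiv p.snd q.snd, V.ldiv_compat p.rel q.rel⟩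
  rdiv p q := ⟨rdiv p.fst q.fst, rdiv p.snd q.snd, V.rdiv_compat p.rel q.rel⟩
  mul_ldiv _ _ := Congruence.Pairs.ext (mul_ldiv _ _) (mul_ldiv _ _)
  rdiv_mul _ _ := Congruence.Pairs.ext (rdiv_mul _ _) (rdiv_mul _ _)
  ldiv_mul _ _ := Congruence.Pairs.ext (ldiv_mul _ _) (ldiv_mul _ _)
  mul_rdiv _ _ := Congruence.Pairs.ext (mul_rdiv _ _) (mul_rdiv _ _)

/-- The diagonal `{(q, q) | q ∈ Q}` of a congruence. -/
def Congruence.diagonal (V : Congruence Q) : Set V.Pairs := {p | p.fst = p.snd}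

/-- A congruence `V` is central if the diagonal is a normal subquasigroup of `V`, that is, a
class of some congruence of the quasigroup `V`. -/
def Congruence.IsCentral (V : Congruence Q) : Prop :=
  ∃ θ : Congruence V.Pairs, V.diagonal ∈ θ.toSetoid.classes

/-- The center congruence: the greatest central congruence. -/
def Congruence.IsCenterCongruence (V : Congruence Q) : Prop :=
  V.IsCentral ∧ ∀ W : Congruence Q, W.IsCentral → ∀ x y : Q, W.r x y → V.r x y

/-- `Z` is a center of `Q`: a class of the center congruence. -/
def IsCenter (Z : Set Q) : Prop :=
  ∃ V : Congruence Q, V.IsCenterCongruence ∧ Z ∈ V.toSetoid.classes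

end Center

/-- A quasigroup is central if it coincides with its center. -/
def IsCentral (Q : Type*) [QGroup Q] : Prop := IsCenter (Set.univ : Set Q)

section Autotopy

variable (Q : Type*) [QGroup Q]

/-- The autotopy group: triples `(α, β, γ)` of permutations of `Q` with
`α x · β y = γ (x · y)`, multiplied componentwise. -/
def Avt : Subgroup (Equiv.Perm Q × Equiv.Perm Q × Equiv.Perm Q) where
  carrier := {T | ∀ x y : Q, T.1 x * T.2.1 y = T.2.2 (x * y)}
  one_mem' _ _ := rfl
  mul_mem' {S T} hS hT x y := (hS (T.1 x) (T.2.1 y)).trans (congrArg S.2.2 (hT x y))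
  inv_mem' {T} hT x y := T.2.2.injective <| by
    have h := hT (T.1.symm x) (T.2.1.symm y)
    rw [Equiv.apply_symm_apply, Equiv.apply_symm_apply] at h
    exact h.symm.trans (Equiv.apply_symm_apply T.2.2 (x * y)).symm

/-- First component of a triple. -/
def comp₁ : Equiv.Perm Q × Equiv.Perm Q × Equiv.Perm Q →* Equiv.Perm Q :=
  MonoidHom.fst _ _

/-- Second component of a triple. -/
def comp₂ : Equiv.Perm Q × Equiv.Perm Q × Equiv.Perm Q →* Equiv.Perm Q :=
  (MonoidHom.fst _ _).comp (MonoidHom.snd _ _)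

/-- Third component of a triple. -/
def comp₃ : Equiv.Perm Q × Equiv.Perm Q × Equiv.Perm Q →* Equiv.Perm Q :=
  (MonoidHom.snd _ _).comp (MonoidHom.snd _ _)

/-- The left A-nucleus: autotopies of the form `(α, ε, γ)`. -/
def leftANucleus : Subgroup (Equiv.Perm Q × Equiv.Perm Q × Equiv.Perm Q) :=
  Avt Q ⊓ (comp₂ Q).ker

/-- The right A-nucleus: autotopies of the form `(ε, β, γ)`. -/
def rightANucleus : Subgroup (Equiv.Perm Q × Equiv.Perm Q × Equiv.Perm Q) :=
  Avt Q ⊓ (comp₁ Q).ker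

/-- The middle A-nucleus: autotopies of the form `(α, β, ε)`. -/
def middleANucleus : Subgroup (Equiv.Perm Q × Equiv.Perm Q × Equiv.Perm Q) :=
  Avt Q ⊓ (comp₃ Q).ker

/-- The left A-center. Any two A-nuclei commute elementwise and meet trivially, so that their
join is their internal direct product. -/
def leftACenter : Subgroup (Equiv.Perm Q × Equiv.Perm Q × Equiv.Perm Q) :=
  (rightANucleus Q ⊔ middleANucleus Q) ⊓ leftANucleus Q

/-- The right A-center. -/
def rightACenter : Subgroup (Equiv.Perm Q × Equiv.Perm Q × Equiv.Perm Q) :=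
  (leftANucleus Q ⊔ middleANucleus Q) ⊓ rightANucleus Q

/-- The middle A-center. -/
def middleACenter : Subgroup (Equiv.Perm Q × Equiv.Perm Q × Equiv.Perm Q) :=
  (leftANucleus Q ⊔ rightANucleus Q) ⊓ middleANucleus Q

/-- A quasigroup is A-central if at least one of the component groups of its A-centers acts
transitively on it. -/
def IsACentral : Prop :=
  MulAction.IsPretransitive ((leftACenter Q).map (comp₁ Q)) Q ∨
  MulAction.IsPretransitive ((leftACenter Q).map (comp₃ Q)) Q ∨
  MulAction.IsPretransitive ((rightACenter Q).map (comp₂ Q)) Q ∨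
  MulAction.IsPretransitive ((rightACenter Q).map (comp₃ Q)) Q ∨
  MulAction.IsPretransitive ((middleACenter Q).map (comp₁ Q)) Q ∨
  MulAction.IsPretransitive ((middleACenter Q).map (comp₂ Q)) Q

end Autotopy

end QGroup

namespace QGroup

/-!
Let `V` be a central congruence of a quasigroup and `θ` a congruence of `V` having the diagonal as
a class. Each class of `θ` is the graph of a permutation of `Q`: the class of `(a, b)` is the
graph of `x ↦ x - a + b`, with the Maltsev term of quasigroups in place of `x - a + b`. Diagonal
pairs give the identity permutation. As `θ` is compatible with multiplication, the permutations
given by `p`, `q` and `p * q` form an autotopy. Taking `q` diagonal gives `(α, ε, γ)` with `α`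
given by `p`; solving `(c, c) * r = p * q` for `r` in `V` gives `(ε, β, γ)` with the same `γ`, so
`(α, ε, γ)` lies in the left A-center. The permutation `α` given by `(x, y)` maps `x` to `y`.
-/

section Malcev

variable {Q : Type*} [QGroup Q]

/-- The Maltsev term `(x / (y \ y)) · (y \ z)` of quasigroups, which plays the role of
`x - y + z`. -/
def malcev (x y z : Q) : Q := rdiv x (ldiv y y) * ldiv y z

theorem malcev_self_right (x y : Q) : malcev x y y = x := rdiv_mul _ _

theorem malcev_self_left (x y : Q) : malcev x x y = y := by
  have rdiv_ldiv_self : rdiv x (ldiv x x) = x := by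
    simpa only [mul_ldiv] using mul_rdiv (ldiv x x) x
  rw [malcev, rdiv_ldiv_self, mul_ldiv]

theorem Congruence.malcev_compat (V : Congruence Q) {a b c d e f : Q}
    (hab : V.r a b) (hcd : V.r c d) (hef : V.r e f) : V.r (malcev a c e) (malcev b d f) :=
  V.mul_compat (V.rdiv_compat hab (V.ldiv_compat hcd hcd)) (V.ldiv_compat hcd hef)

end Malcev

theorem mem_leftACenter {Q : Type*} [QGroup Q] {α β γ : Equiv.Perm Q}
    (hl : (α, 1, γ) ∈ leftANucleus Q) (hr : (1, β, γ) ∈ rightANucleus Q) :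
    (α, 1, γ) ∈ leftACenter Q := by
  have hm : (1, β, γ)⁻¹ * (α, 1, γ) ∈ middleANucleus Q :=
    ⟨(Avt Q).mul_mem ((Avt Q).inv_mem hr.1) hl.1, inv_mul_cancel γ⟩
  have h := Subgroup.mul_mem_sup hr hm
  rw [mul_inv_cancel_left] at h
  exact ⟨h, hl⟩

section CentralCongruence

variable {Q : Type*} [QGroup Q] {V : Congruence Q}

/-- The diagonal element `(x, x)` of a congruence regarded as a quasigroup of pairs. -/
def Congruence.diag (V : Congruence Q) (x : Q) : V.Pairs := ⟨x, x, V.refl' x⟩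

variable {θ : Congruence V.Pairs} {p q : V.Pairs} (hθ : V.diagonal ∈ θ.toSetoid.classes)
include hθ

theorem rel_diag (x y : Q) : θ.r (V.diag x) (V.diag y) :=
  (Setoid.rel_iff_exists_classes _).2 ⟨V.diagonal, hθ, rfl, rfl⟩

theorem fst_eq_snd_of_rel_diag {x : Q} (h : θ.r p (V.diag x)) : p.fst = p.snd := by
  obtain ⟨s, hs, hps, hxs⟩ := (Setoid.rel_iff_exists_classes _).1 h
  have hs_diagonal : s = V.diagonal :=
    Setoid.eq_of_mem_classes hs hxs hθ (rfl : V.diag x ∈ V.diagonal)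
  rwa [hs_diagonal] at hps

theorem rel_malcev_diag (p : V.Pairs) (x y : Q) :
    θ.r p (malcev p (V.diag x) (V.diag y)) := by
  simpa only [malcev_self_right] using
    θ.malcev_compat (θ.refl' p) (θ.refl' (V.diag x)) (rel_diag hθ x y)

theorem malcev_fst_eq_malcev_snd_of_rel (h : θ.r p q) (x : Q) :
    malcev p.fst q.fst x = malcev p.snd q.snd x := by
  have h_diag : θ.r (malcev p q (V.diag x)) (V.diag x) := by
    simpa only [malcev_self_left] using
      θ.malcev_compat h (θ.refl' q) (θ.refl' (V.diag x))
  exact fst_eq_snd_of_rel_diag hθ h_diag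

theorem fst_eq_fst_iff_snd_eq_snd_of_rel (h : θ.r p q) : p.fst = q.fst ↔ p.snd = q.snd := by
  constructor <;> intro heq
  · symm
    simpa only [heq, malcev_self_left, malcev_self_right] using
      malcev_fst_eq_malcev_snd_of_rel hθ h q.snd
  · simpa only [heq, malcev_self_left, malcev_self_right] using
      malcev_fst_eq_malcev_snd_of_rel hθ h q.fst

/-- The permutation of `Q` whose graph is the class of the pair `p` modulo a congruence `θ` that
has the diagonal as a class. -/
def translation (p : V.Pairs) : Equiv.Perm Q where
  toFun := malcev p.snd p.fst
  invFun := malcev p.fst p.snd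
  left_inv x := by
    have h : θ.r (malcev p (V.diag p.snd) (V.diag (malcev p.snd p.fst x)))
        (malcev p (V.diag p.fst) (V.diag x)) :=
      θ.trans' (θ.symm' (rel_malcev_diag hθ p _ _)) (rel_malcev_diag hθ p _ _)
    exact ((fst_eq_fst_iff_snd_eq_snd_of_rel hθ h).2 (malcev_self_left _ _)).trans
      (malcev_self_left _ _)
  right_inv y := by
    have h : θ.r (malcev p (V.diag p.fst) (V.diag (malcev p.fst p.snd y)))
        (malcev p (V.diag p.snd) (V.diag y)) :=
      θ.trans' (θ.symm' (rel_malcev_diag hθ p _ _)) (rel_malcev_diag hθ p _ _)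
    exact ((fst_eq_fst_iff_snd_eq_snd_of_rel hθ h).1 (malcev_self_left _ _)).trans
      (malcev_self_left _ _)

theorem translation_fst (p : V.Pairs) : translation hθ p p.fst = p.snd := malcev_self_right _ _

theorem translation_diag (x : Q) : translation hθ (V.diag x) = 1 :=
  Equiv.ext (malcev_self_left x)

theorem exists_rel_translation (p : V.Pairs) (x : Q) :
    ∃ q : V.Pairs, θ.r p q ∧ q.fst = x ∧ q.snd = translation hθ p x :=
  ⟨malcev p (V.diag p.fst) (V.diag x), rel_malcev_diag hθ p _ _, malcev_self_left _ _, rfl⟩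

theorem translation_fst_of_rel (h : θ.r p q) : translation hθ p q.fst = q.snd := by
  obtain ⟨q', hpq', hfst, hsnd⟩ := exists_rel_translation hθ p q.fst
  rw [← hsnd]
  exact (fst_eq_fst_iff_snd_eq_snd_of_rel hθ (θ.trans' (θ.symm' hpq') h)).1 hfst

theorem translation_mem_Avt (p q : V.Pairs) :
    (translation hθ p, translation hθ q, translation hθ (p * q)) ∈ Avt Q := by
  intro x y
  obtain ⟨p', hp, rfl, hp'⟩ := exists_rel_translation hθ p x
  obtain ⟨q', hq, rfl, hq'⟩ := exists_rel_translation hθ q y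
  calc translation hθ p p'.fst * translation hθ q q'.fst
      = (p' * q').snd := by rw [← hp', ← hq']; rfl
    _ = translation hθ (p * q) (p' * q').fst :=
      (translation_fst_of_rel hθ (θ.mul_compat hp hq)).symm

theorem translation_mem_leftANucleus (p : V.Pairs) (x : Q) :
    (translation hθ p, 1, translation hθ (p * V.diag x)) ∈ leftANucleus Q :=
  ⟨translation_diag hθ x ▸ translation_mem_Avt hθ p (V.diag x), rfl⟩

theorem translation_mem_rightANucleus (p : V.Pairs) (x : Q) :
    (1, translation hθ p, translation hθ (V.diag x * p)) ∈ rightANucleus Q :=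
  ⟨translation_diag hθ x ▸ translation_mem_Avt hθ (V.diag x) p, rfl⟩

theorem translation_mem_leftACenter (p : V.Pairs) (x : Q) :
    (translation hθ p, 1, translation hθ (p * V.diag x)) ∈ leftACenter Q := by
  have hr := translation_mem_rightANucleus hθ (ldiv (V.diag x) (p * V.diag x)) x
  rw [mul_ldiv] at hr
  exact mem_leftACenter (translation_mem_leftANucleus hθ p x) hr

end CentralCongruence

end QGroup

theorem mainTheorem4_general {Q : Type*} [QGroup Q] {V : QGroup.Congruence Q} (hV : V.IsCentral)
    {x y : Q} (hxy : V.r x y) :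
    y ∈ MulAction.orbit ((QGroup.leftACenter Q).map (QGroup.comp₁ Q)) x := by
  obtain ⟨θ, hθ⟩ := hV
  let p : V.Pairs := ⟨x, y, hxy⟩
  exact ⟨⟨QGroup.translation hθ p, _, QGroup.translation_mem_leftACenter hθ p x, rfl⟩,
    QGroup.translation_fst hθ p⟩

theorem mainTheorem4 (Q : Type*) [QGroup Q] [Nonempty Q] (hQ : QGroup.IsCentral Q) :
    QGroup.IsACentral Q := by
  obtain ⟨V, ⟨hV, -⟩, hclass⟩ := hQ
  have rel_all (x y : Q) : V.r x y :=
    (Setoid.rel_iff_exists_classes _).2 ⟨Set.univ, hclass, trivial, trivial⟩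
  exact Or.inl ⟨fun x y => mainTheorem4_general hV (rel_all x y)⟩
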